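/- For a finite connected simple graph $G$, a configuration assigns a nonnegative number of pebbles to each vertex. A pebbling move removes two pebbles from one vertex and adds one pebble at an adjacent vertex. A configuration is solvable if, for every vertex $r$, some (possibly empty) sequence of pebbling moves leads to a configuration with at least one pebble at $r$. The pebbling number $\pi(G)$ is the least positive integer $k$ such that every configuration with exactly $k$ pebbles is solvable. The Cartesian product $G\,\square\,H$ has vertex set $V(G)\times V(H)$, where $(g,h)\sim(g',h')$ if $g=g'$ and $h\sim_H h'$, or $h=h'$ and $g\sim_G g'$. Let $L, L_1, L_2$ be the three minimal Lemke graphs on the vertices $v_1,\dots,v_8$ (write $ij$ for the edge $v_iv_j$), with edge sets \begin{align*} E(L)&=\{12,13,24,35,36,37,45,46,47,48,58,68,78\},\\ E(L_1)&=\{12,13,23,24,35,36,37,45,48,58,68,78\},\\ E(L_2)&=\{12,13,24,35,36,37,45,47,48,56,58,67,68,78\}. \end{align*} Corollary. Graham's conjecture holds for $G\,\square\,H$ whenever $G\in\{L,L_1,L_2\}$ and $H\in\{K_8,K_{12},K_{4,4},K_{6,6}\}$; that is, in each of these twelve cases \[\pi(G\,\square\,H)\le\pi(G)\,\pi(H).\]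 -/

import Mathlib

/-- A configuration of pebbles on the vertex set `V`. -/
abbrev PebbleConfig (V : Type*) := V → ℕ

/-- One pebbling move from `c` to `c'`: two pebbles are removed from a vertex `u` and one pebble
is added at an adjacent vertex `v`. Since `u ≠ v`, the equation at `u` reads `c' u + 2 = c u`, so
there are at least two pebbles at `u` before the move. -/
def PebblingMove {V : Type*} [DecidableEq V] (G : SimpleGraph V) (c c' : PebbleConfig V) : Prop :=
  ∃ u v : V, G.Adj u v ∧ c' + Pi.single u 2 = c + Pi.single v 1

/-- A configuration is solvable if for every root `r` some (possibly empty) sequence of pebbling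
moves leads to a configuration with at least one pebble at `r`. -/
def PebblingSolvable {V : Type*} [DecidableEq V] (G : SimpleGraph V) (c : PebbleConfig V) : Prop :=
  ∀ r : V, ∃ c' : PebbleConfig V, Relation.ReflTransGen (PebblingMove G) c c' ∧ 1 ≤ c' r

/-- The pebbling number `π(G)`: the least positive integer `k` such that all configurations with
exactly `k` pebbles are solvable. By `pebblingNumber_isLeast` below, this least integer exists for
every finite connected graph. -/
noncomputable def pebblingNumber {V : Type*} [Fintype V] [DecidableEq V]
    (G : SimpleGraph V) : ℕ :=
  sInf {k : ℕ | 0 < k ∧ ∀ c : PebbleConfig V, ∑ v, c v = k → PebblingSolvable G c}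

theorem pebbling_moves_along_edge {V : Type*} [DecidableEq V] {G : SimpleGraph V} {u v : V}
    (h : G.Adj u v) (m : ℕ) (c : PebbleConfig V) :
    Relation.ReflTransGen (PebblingMove G) (c + Pi.single u (2 * m)) (c + Pi.single v m) := by
  induction m generalizing c with
  | zero => simp; exact Relation.ReflTransGen.refl
  | succ m ih =>
    have h1 : PebblingMove G (c + Pi.single u (2 * (m + 1)))
        ((c + Pi.single v 1) + Pi.single u (2 * m)) := by
      refine ⟨u, v, h, ?_⟩
      rw [mul_add, mul_one, Pi.single_add]
      abel
    have h2 := ih (c + Pi.single v 1)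
    have h3 : c + Pi.single v 1 + Pi.single v m = c + Pi.single v (m + 1) := by
      rw [Pi.single_add]; abel
    rw [h3] at h2
    exact Relation.ReflTransGen.head h1 h2

theorem pebbling_moves_along_walk {V : Type*} [DecidableEq V] {G : SimpleGraph V} {u r : V}
    (p : G.Walk u r) (c : PebbleConfig V) :
    Relation.ReflTransGen (PebblingMove G) (c + Pi.single u (2 ^ p.length))
      (c + Pi.single r 1) := by
  induction p with
  | nil => simp; exact Relation.ReflTransGen.refl
  | cons h p ih =>
    rw [SimpleGraph.Walk.length_cons, pow_succ']
    exact (pebbling_moves_along_edge h _ c).trans ih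

/-- The pebbling number of a finite connected graph is well defined. -/
theorem pebblingNumber_isLeast {V : Type*} [Fintype V] [DecidableEq V] {G : SimpleGraph V}
    (hG : G.Connected) :
    IsLeast {k : ℕ | 0 < k ∧ ∀ c : PebbleConfig V, ∑ v, c v = k → PebblingSolvable G c}
      (pebblingNumber G) := by
  have hne : Nonempty V := hG.nonempty
  refine ⟨Nat.sInf_mem ⟨Fintype.card V * 2 ^ Fintype.card V,
    Nat.mul_pos Fintype.card_pos (by positivity), ?_⟩, fun k hk => Nat.sInf_le hk⟩
  intro c hc r
  obtain ⟨u, hu⟩ : ∃ u, 2 ^ Fintype.card V ≤ c u := by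
    by_contra! hlt
    have := Finset.sum_lt_sum_of_nonempty (Finset.univ_nonempty (α := V)) fun v _ => hlt v
    simp [hc] at this
  obtain ⟨p, hp⟩ := (hG.preconnected u r).exists_isPath
  have hle : 2 ^ p.length ≤ c u :=
    (Nat.pow_le_pow_right (by norm_num) hp.length_lt.le).trans hu
  have hsub : c - Pi.single u (2 ^ p.length) + Pi.single u (2 ^ p.length) = c := by
    ext w
    by_cases hw : w = u
    · subst hw; simp [hle]
    · simp [hw]
  refine ⟨c - Pi.single u (2 ^ p.length) + Pi.single r 1, ?_, by simp⟩
  have := pebbling_moves_along_walk p (c - Pi.single u (2 ^ p.length))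
  rwa [hsub] at this

/-- The Lemke graph `L` (13 edges); the vertex `vᵢ` is `i - 1 : Fin 8`. -/
def lemkeGraph : SimpleGraph (Fin 8) :=
  SimpleGraph.fromEdgeSet
    {s(0, 1), s(0, 2), s(1, 3), s(2, 4), s(2, 5), s(2, 6), s(3, 4), s(3, 5), s(3, 6), s(3, 7),
      s(4, 7), s(5, 7), s(6, 7)}

/-- The minimal Lemke graph `L₁` (12 edges); the vertex `vᵢ` is `i - 1 : Fin 8`. -/
def lemkeGraph1 : SimpleGraph (Fin 8) :=
  SimpleGraph.fromEdgeSet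
    {s(0, 1), s(0, 2), s(1, 2), s(1, 3), s(2, 4), s(2, 5), s(2, 6), s(3, 4), s(3, 7),
      s(4, 7), s(5, 7), s(6, 7)}

/-- The minimal Lemke graph `L₂` (14 edges); the vertex `vᵢ` is `i - 1 : Fin 8`. -/
def lemkeGraph2 : SimpleGraph (Fin 8) :=
  SimpleGraph.fromEdgeSet
    {s(0, 1), s(0, 2), s(1, 3), s(2, 4), s(2, 5), s(2, 6), s(3, 4), s(3, 6), s(3, 7), s(4, 5),
      s(4, 7), s(5, 6), s(5, 7), s(6, 7)}

/-!
Let `G` be one of the three graphs and let `H` have `2 * m` vertices and contain a spanning complete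
bipartite graph with sides of size `m`; this covers the complete graphs as well as the complete
bipartite ones. Since `π(G) ≥ 8` and `π(H) ≥ 2 * m` (`card_le_pebblingNumber`), it is enough that
every configuration of `16 * m` pebbles on the product reaches every root `(r, s)`.

The property of `G` used for this (`NearlyOddTwoPebbling`) is that eight pebbles bring one pebble to
`r`, and that two pebbles can be brought to `r` as soon as the rounded-up halves of the numbers of
pebbles sum to at least nine. The second part is the two-pebbling property with odd vertices in
place of occupied ones. It just fails for the Lemke graphs: the sum may be exactly nine with nine
or more pebbles on one particular vertex `g`, which depends only on `r`.

View the product as copies of `G`, one for each vertex of `H`: the copy at `s`, the `m` copies on the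
other side (`B`), and the remaining `m - 1` copies on the side of `s` (`A`). Suppose that `(r, s)`
cannot be reached. Sending all pairs of pebbles from `B` to the copy at `s` shows that there are at
most seven pebbles at `s` and pairs in `B` altogether, and no copy in `B` can bring two pebbles to
`r`, even after it has received all pairs from `A`. If no copy in `A` can bring two pebbles to `r`
either, adding up these bounds contradicts the total `16 * m` (`pebblingReaches_of_forall_not_two`);
exceptional copies cost one each in the count, but their pairs at `g` make up for it, as two pebbles
arriving at `g` raise a rounded-up half elsewhere. At most one copy in `A` can bring two pebbles to
`r`, because two of them would yield two pebbles at some `(r, b)`. If there is one, then no copy in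
`B` can be raised to eight pebbles using the pairs that this copy does not need itself, and this
again bounds the total (`pebblingReaches_of_two`).

The property of `G` is verified by the kernel. By monotonicity only finitely many configurations
matter. For each root, a fixed tree strategy settles most of them; the search enumerates just those
on which it fails, and tries up to three further moves followed by one of two tree strategies.
-/

/-! ### Reachability by pebbling moves -/

/-- From `c` some sequence of pebbling moves leads to at least `k` pebbles at `r`. -/
def PebblingReaches {V : Type*} [DecidableEq V] (G : SimpleGraph V) (c : PebbleConfig V) (r : V)
    (k : ℕ) : Prop :=
  ∃ c' : PebbleConfig V, Relation.ReflTransGen (PebblingMove G) c c' ∧ k ≤ c' r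

theorem PebblingMove.add_right {V : Type*} [DecidableEq V] {G : SimpleGraph V}
    {c c' : PebbleConfig V} (h : PebblingMove G c c') (d : PebbleConfig V) :
    PebblingMove G (c + d) (c' + d) := by
  obtain ⟨u, v, huv, h⟩ := h
  exact ⟨u, v, huv, by rw [add_right_comm, h, add_right_comm]⟩

theorem pebblingMoves_add_right {V : Type*} [DecidableEq V] {G : SimpleGraph V}
    {c c' : PebbleConfig V} (h : Relation.ReflTransGen (PebblingMove G) c c')
    (d : PebbleConfig V) : Relation.ReflTransGen (PebblingMove G) (c + d) (c' + d) :=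
  h.lift (fun x => x + d) fun _ _ h => h.add_right d

theorem pebblingMoves_add_left {V : Type*} [DecidableEq V] {G : SimpleGraph V}
    {c c' : PebbleConfig V} (h : Relation.ReflTransGen (PebblingMove G) c c')
    (d : PebbleConfig V) : Relation.ReflTransGen (PebblingMove G) (d + c) (d + c') := by
  simpa only [add_comm] using pebblingMoves_add_right h d

/-- Simultaneous moves along a finite family of edges. -/
theorem pebblingMoves_sum_edges {V ι : Type*} [DecidableEq V] {G : SimpleGraph V} (I : Finset ι)
    (e f : ι → V) (m : ι → ℕ) (h : ∀ i ∈ I, G.Adj (e i) (f i)) :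
    Relation.ReflTransGen (PebblingMove G) (∑ i ∈ I, Pi.single (e i) (2 * m i))
      (∑ i ∈ I, Pi.single (f i) (m i)) := by
  classical
  induction I using Finset.induction_on with
  | empty => simpa using Relation.ReflTransGen.refl
  | insert a s ha ih =>
    rw [Finset.sum_insert ha, Finset.sum_insert ha]
    have h1 := pebblingMoves_add_left (ih fun i hi => h i (Finset.mem_insert_of_mem hi))
      (Pi.single (e a) (2 * m a))
    have h2 := pebbling_moves_along_edge (h a (Finset.mem_insert_self a s)) (m a) 0
    rw [zero_add, zero_add] at h2
    exact h1.trans (pebblingMoves_add_right h2 _)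

namespace PebblingReaches

variable {V : Type*} [DecidableEq V] {G : SimpleGraph V} {c c' : PebbleConfig V} {r : V} {k : ℕ}

theorem of_le_apply (h : k ≤ c r) : PebblingReaches G c r k := ⟨c, .refl, h⟩

theorem of_moves (h : Relation.ReflTransGen (PebblingMove G) c c') (h' : PebblingReaches G c' r k) :
    PebblingReaches G c r k := by
  obtain ⟨d, hd, hk⟩ := h'
  exact ⟨d, h.trans hd, hk⟩

theorem mono (h : PebblingReaches G c r k) (hc : c ≤ c') : PebblingReaches G c' r k := by
  obtain ⟨d, hd, hk⟩ := h
  refine ⟨d + (c' - c), ?_, hk.trans (Nat.le_add_right _ _)⟩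
  have := pebblingMoves_add_right hd (c' - c)
  rwa [add_tsub_cancel_of_le hc] at this

end PebblingReaches

/-- The pebbling number is at least the number of vertices: one pebble on each vertex of a set
that misses `r` allows no move. The hypothesis makes the set whose infimum is taken nonempty. -/
theorem card_le_pebblingNumber {V : Type*} [Fintype V] [DecidableEq V] {G : SimpleGraph V}
    (hG : {k : ℕ | 0 < k ∧ ∀ c : PebbleConfig V, ∑ v, c v = k → PebblingSolvable G c}.Nonempty) :
    Fintype.card V ≤ pebblingNumber G := by
  by_contra! hlt
  obtain ⟨-, hk⟩ := Nat.sInf_mem hG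
  change ∀ c : PebbleConfig V, ∑ v, c v = pebblingNumber G → PebblingSolvable G c at hk
  obtain ⟨S, -, hS⟩ := Finset.exists_subset_card_eq (s := (Finset.univ : Finset V)) hlt.le
  obtain ⟨r, hr⟩ : ∃ r, r ∉ S := by
    by_contra! hall
    rw [← hS, Finset.eq_univ_of_forall hall, Finset.card_univ] at hlt
    exact hlt.false
  obtain ⟨c', hc', h1⟩ := hk (fun v => if v ∈ S then 1 else 0) (by simp [hS]) r
  rcases hc'.cases_head with rfl | ⟨d, ⟨u, v, huv, hd⟩, -⟩
  · simp [hr] at h1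
  · have := congrFun hd u
    simp only [Pi.add_apply, Pi.single_eq_same, Pi.single_eq_of_ne huv.ne] at this
    split_ifs at this
    all_goals omega

/-! ### Layers of a product -/

section Layers

variable {V β : Type*} [DecidableEq V] [DecidableEq β] {G : SimpleGraph V} {H : SimpleGraph β}

/-- The configuration on `V × β` whose restriction to the copy of `V` at `h : β` is `C h`. -/
def layers (C : β → V → ℕ) : PebbleConfig (V × β) := fun p => C p.2 p.1

/-- Moves inside one layer. -/
theorem layers_moves_update (C : β → V → ℕ) (h : β) {a a' : V → ℕ}
    (ha : Relation.ReflTransGen (PebblingMove G) a a') :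
    Relation.ReflTransGen (PebblingMove (G.boxProd H)) (layers (Function.update C h a))
      (layers (Function.update C h a')) := by
  refine ha.lift (fun x => layers (Function.update C h x)) ?_
  rintro x y ⟨u, v, huv, e⟩
  refine ⟨(u, h), (v, h), by simp [SimpleGraph.boxProd_adj, huv], ?_⟩
  ext ⟨w, k⟩
  by_cases hk : k = h
  · subst hk
    have := congrFun e w
    simpa [layers, Pi.single_apply] using this
  · simp [layers, hk]

theorem pebblingReaches_layers_of_update {C : β → V → ℕ} {h : β} {a : V → ℕ} {r : V} {s : β}
    {k : ℕ} (ha : Relation.ReflTransGen (PebblingMove G) (C h) a)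
    (hs : PebblingReaches (G.boxProd H) (layers (Function.update C h a)) (r, s) k) :
    PebblingReaches (G.boxProd H) (layers C) (r, s) k := by
  have := layers_moves_update (H := H) C h ha
  rw [Function.update_eq_self] at this
  exact hs.of_moves this

/-- The layers after `2 * y h v` pebbles at `(v, h)` have been exchanged for `y h v` pebbles at
`(v, b)`, for every `h ∈ A` and every `v`. -/
def pushLayers (C : β → V → ℕ) (A : Finset β) (b : β) (y : β → V → ℕ) : β → V → ℕ := fun h =>
  if h = b then C b + ∑ a ∈ A, y a else if h ∈ A then C h - 2 • y h else C h

theorem pebblingReaches_of_pushLayers [Fintype V] {C : β → V → ℕ} {A : Finset β} {b : β}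
    {y : β → V → ℕ} {r : V} {s : β} {k : ℕ} (hA : ∀ h ∈ A, H.Adj h b)
    (hy : ∀ h ∈ A, ∀ v, 2 * y h v ≤ C h v)
    (hs : PebblingReaches (G.boxProd H) (layers (pushLayers C A b y)) (r, s) k) :
    PebblingReaches (G.boxProd H) (layers C) (r, s) k := by
  have hb : b ∉ A := fun h => (hA b h).ne rfl
  have key := pebblingMoves_add_left (pebblingMoves_sum_edges (G := G.boxProd H)
    (A ×ˢ (Finset.univ : Finset V)) (fun i => (i.2, i.1)) (fun i => (i.2, b))
    (fun i => y i.1 i.2) (by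
      rintro ⟨h, v⟩ hi
      simp only [Finset.mem_product, Finset.mem_univ, and_true] at hi
      simp [SimpleGraph.boxProd_adj, hA h hi]))
    (layers fun h => if h ∈ A then C h - 2 • y h else C h)
  have e1 : (layers fun h => if h ∈ A then C h - 2 • y h else C h) +
      ∑ i ∈ A ×ˢ (Finset.univ : Finset V), Pi.single (i.2, i.1) (2 * y i.1 i.2) = layers C := by
    ext ⟨w, k⟩
    simp only [Pi.add_apply, Finset.sum_apply, Finset.sum_product, Pi.single_apply, Prod.mk.injEq,
      layers, ite_and, Finset.sum_ite_eq, Finset.mem_univ, if_true]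
    by_cases hk : k ∈ A
    · simp only [hk, if_true, Pi.sub_apply, Pi.smul_apply, smul_eq_mul]
      have := hy k hk w
      omega
    · simp [hk]
  have e2 : (layers fun h => if h ∈ A then C h - 2 • y h else C h) +
      ∑ i ∈ A ×ˢ (Finset.univ : Finset V), Pi.single (i.2, b) (y i.1 i.2) =
        layers (pushLayers C A b y) := by
    ext ⟨w, k⟩
    simp only [Pi.add_apply, Finset.sum_apply, Finset.sum_product, Pi.single_apply, Prod.mk.injEq,
      layers, ite_and, Finset.sum_ite_eq, Finset.mem_univ, if_true, pushLayers]
    by_cases hk : k = b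
    · subst hk; simp [hb]
    · simp [hk]
  rw [e1, e2] at key
  exact hs.of_moves key

end Layers

/-! ### Moving pebbles between layers -/

section Transfer

variable {V β : Type*} [DecidableEq V] [DecidableEq β] {G : SimpleGraph V} {H : SimpleGraph β}
  {r : V} {s : β} {k : ℕ} {C : β → V → ℕ}

theorem pebblingReaches_layers_mono {C' : β → V → ℕ}
    (hs : PebblingReaches (G.boxProd H) (layers C) (r, s) k) (h : ∀ b, C b ≤ C' b) :
    PebblingReaches (G.boxProd H) (layers C') (r, s) k :=
  hs.mono fun p => h p.2 p.1

theorem pebblingReaches_layers_of_self (hs : PebblingReaches G (C s) r k) :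
    PebblingReaches (G.boxProd H) (layers C) (r, s) k := by
  obtain ⟨a, ha, hk⟩ := hs
  exact pebblingReaches_layers_of_update ha (.of_le_apply (by simpa [layers] using hk))

/-- Two pebbles collected at `(r, h)` are exchanged for one at `(r, h')`; whatever else is left in
the layer of `h` is discarded. -/
theorem pebblingReaches_layers_of_carry [Fintype V] {h h' : β} (hh : H.Adj h h')
    (h2 : PebblingReaches G (C h) r 2)
    (hs : PebblingReaches (G.boxProd H) (layers fun k =>
      if k = h' then C h' + Pi.single r 1 else if k = h then 0 else C k) (r, s) k) :
    PebblingReaches (G.boxProd H) (layers C) (r, s) k := by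
  obtain ⟨a, ha, hk⟩ := h2
  refine pebblingReaches_layers_of_update ha ?_
  refine pebblingReaches_of_pushLayers (A := {h}) (b := h') (y := fun _ => Pi.single r 1)
    (by simpa using hh) ?_ (pebblingReaches_layers_mono hs ?_)
  · intro i hi v
    rw [Finset.mem_singleton] at hi
    subst hi
    by_cases hv : v = r
    · subst hv; simpa using hk
    · simp [hv]
  · intro i
    have hne : h' ≠ h := hh.ne.symm
    by_cases h1 : i = h'
    · subst h1; simp [pushLayers, hne]
    · by_cases h3 : i = h
      · subst h3; simp [pushLayers, h1]
      · simp [pushLayers, h1, h3]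

theorem pebblingReaches_of_two_at_neighbor [Fintype V] {b : β} (hb : H.Adj b s)
    (h2 : PebblingReaches G (C b) r 2) :
    PebblingReaches (G.boxProd H) (layers C) (r, s) 1 :=
  pebblingReaches_layers_of_carry hb h2 (.of_le_apply (by simp [layers]))

/-- A layer at distance two that yields two pebbles helps a layer at distance one that yields only
one. -/
theorem pebblingReaches_of_two_and_one [Fintype V] {h b : β} (hb : H.Adj b s) (hh : H.Adj h b)
    (h2 : PebblingReaches G (C h) r 2) (h1 : PebblingReaches G (C b) r 1) :
    PebblingReaches (G.boxProd H) (layers C) (r, s) 1 := by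
  obtain ⟨a, ha, hk⟩ := h1
  refine pebblingReaches_layers_of_update ha (pebblingReaches_layers_of_carry hh ?_
    (pebblingReaches_of_two_at_neighbor hb (.of_le_apply ?_)))
  · rwa [Function.update_of_ne hh.ne]
  · simp only [if_true, Function.update_self, Pi.add_apply, Pi.single_eq_same]
    omega

theorem pebblingReaches_of_two_and_two [Fintype V] {h h' b : β} (hb : H.Adj b s)
    (hh : H.Adj h b) (hh' : H.Adj h' b) (hne : h ≠ h') (h2 : PebblingReaches G (C h) r 2)
    (h2' : PebblingReaches G (C h') r 2) :
    PebblingReaches (G.boxProd H) (layers C) (r, s) 1 := by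
  refine pebblingReaches_layers_of_carry hh h2 (pebblingReaches_of_two_and_one hb hh' ?_
    (.of_le_apply (by simp)))
  simpa [hh'.ne, hne.symm] using h2'

end Transfer

/-! ### Counting with halves -/

/-- The number of disjoint pairs of pebbles on common vertices, which is the number of pebbles that
arrive when a layer sends all its pairs to an adjacent layer. -/
def floorHalf {V : Type*} [Fintype V] (c : V → ℕ) : ℕ := ∑ v, c v / 2

/-- The sum of the rounded-up halves of `c`. It equals `(p + q) / 2` for `p` the number of pebbles
and `q` the number of vertices with an odd number of pebbles, and is the quantity that controls
whether two pebbles can be brought to a vertex. -/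
def ceilHalf {V : Type*} [Fintype V] (c : V → ℕ) : ℕ := ∑ v, (c v + 1) / 2

section Halves

variable {V : Type*} [Fintype V] (c d : V → ℕ)

theorem ceilHalf_add_floorHalf : ceilHalf c + floorHalf c = ∑ v, c v := by
  rw [ceilHalf, floorHalf, ← Finset.sum_add_distrib]
  exact Finset.sum_congr rfl fun v _ => by omega

theorem ceilHalf_le_floorHalf_add_card : ceilHalf c ≤ floorHalf c + Fintype.card V := by
  rw [ceilHalf, floorHalf, Fintype.card_eq_sum_ones, ← Finset.sum_add_distrib]
  exact Finset.sum_le_sum fun v _ => by omega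

theorem half_le_floorHalf (g : V) : c g / 2 ≤ floorHalf c :=
  Finset.single_le_sum (f := fun v => c v / 2) (fun _ _ => Nat.zero_le _) (Finset.mem_univ g)

theorem ceilHalf_add_half_le [DecidableEq V] (g : V) :
    ceilHalf c + d g / 2 ≤ ceilHalf (c + d) := by
  have h : d g / 2 = ∑ v, if v = g then d v / 2 else 0 := by simp
  rw [ceilHalf, ceilHalf, h, ← Finset.sum_add_distrib]
  refine Finset.sum_le_sum fun v _ => ?_
  simp only [Pi.add_apply]
  split_ifs <;> omega

theorem ceilHalf_sub_two_mul {y : V → ℕ} (h : ∀ v, 2 * y v ≤ c v) :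
    ceilHalf (c - 2 • y) + ∑ v, y v = ceilHalf c := by
  rw [ceilHalf, ceilHalf, ← Finset.sum_add_distrib]
  refine Finset.sum_congr rfl fun v _ => ?_
  have := h v
  simp only [Pi.sub_apply, Pi.smul_apply, smul_eq_mul]
  omega

/-- Below a function of large sum there is one of any smaller sum. -/
theorem exists_le_sum_eq {V : Type*} [Fintype V] (f : V → ℕ) {n : ℕ} (h : n ≤ ∑ v, f v) :
    ∃ y : V → ℕ, y ≤ f ∧ ∑ v, y v = n := by
  classical
  induction n with
  | zero => exact ⟨0, fun v => Nat.zero_le _, by simp⟩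
  | succ n ih =>
    obtain ⟨y, hy, hn⟩ := ih (by omega)
    obtain ⟨v, hv⟩ : ∃ v, y v < f v := by
      by_contra! hall
      have := Finset.sum_le_sum fun v (_ : v ∈ Finset.univ) => hall v
      omega
    refine ⟨y + Pi.single v 1, fun w => ?_, by simp [Finset.sum_add_distrib, hn]⟩
    by_cases hw : w = v
    · subst hw; simpa using hv
    · simpa [hw] using hy w

end Halves

/-! ### Products with graphs containing a balanced complete bipartite graph -/

/-- Eight pebbles suffice to reach `r`, and a configuration `c` with `9 ≤ ceilHalf c` can bring two
pebbles to `r`, except possibly when `ceilHalf c = 9` and at least nine pebbles lie on `g`. -/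
structure NearlyOddTwoPebbling {V : Type*} [Fintype V] [DecidableEq V] (G : SimpleGraph V)
    (r g : V) : Prop where
  one : ∀ c : V → ℕ, 8 ≤ ∑ v, c v → PebblingReaches G c r 1
  two : ∀ c : V → ℕ, 9 ≤ ceilHalf c →
    PebblingReaches G c r 2 ∨ (ceilHalf c = 9 ∧ 9 ≤ c g)

/-- The two sides of a balanced complete bipartite subgraph of `H`, with the vertex `s` taken out
of the first side: every vertex of `B` is adjacent to `s` and to every vertex of `A`, and
`insert s A` and `B` have `m` elements each. -/
structure IsPuncturedBiclique {β : Type*} (H : SimpleGraph β) (s : β) (A B : Finset β) (m : ℕ) :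
    Prop where
  notMem : s ∉ A
  adj_root : ∀ b ∈ B, H.Adj b s
  adj : ∀ a ∈ A, ∀ b ∈ B, H.Adj a b
  card_left : A.card + 1 = m
  card_right : B.card = m

theorem IsPuncturedBiclique.notMem_left {β : Type*} {H : SimpleGraph β} {s : β} {A B : Finset β}
    {m : ℕ} (hH : IsPuncturedBiclique H s A B m) {b : β} (hb : b ∈ B) : b ∉ A :=
  fun h => (hH.adj b h b hb).ne rfl

/-- The layer of `b` after all layers in `S` have sent it their pairs. -/
def gathered {V β : Type*} (C : β → V → ℕ) (S : Finset β) (b : β) : V → ℕ :=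
  C b + ∑ a ∈ S, fun v => C a v / 2

theorem sum_gathered {V β : Type*} [Fintype V] (C : β → V → ℕ) (S : Finset β) (b : β) :
    ∑ v, gathered C S b v = ∑ v, C b v + ∑ a ∈ S, floorHalf (C a) := by
  simp only [gathered, Pi.add_apply, Finset.sum_apply, Finset.sum_add_distrib]
  rw [Finset.sum_comm]
  rfl

section Product

variable {V β : Type*} [Fintype V] [DecidableEq V] [DecidableEq β] {G : SimpleGraph V}
  {H : SimpleGraph β} {r g : V} {s : β} {A B : Finset β} {m : ℕ} {C : β → V → ℕ}

namespace NearlyOddTwoPebbling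

theorem of_ten (hG : NearlyOddTwoPebbling G r g) {c : V → ℕ} (h : 10 ≤ ceilHalf c) :
    PebblingReaches G c r 2 :=
  (hG.two c (by omega)).resolve_right (by omega)

theorem ceilHalf_le (hG : NearlyOddTwoPebbling G r g) {c : V → ℕ}
    (h : ¬ PebblingReaches G c r 2) : ceilHalf c ≤ 9 ∧ (ceilHalf c = 9 → 9 ≤ c g) := by
  by_cases h9 : 9 ≤ ceilHalf c
  · have := (hG.two c h9).resolve_left h
    exact ⟨this.1.le, fun _ => this.2⟩
  · omega

end NearlyOddTwoPebbling

/-- Eight pebbles in the layer of `s`, counting those that arrive when all neighbouring layers send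
their pairs, suffice. -/
theorem pebblingReaches_of_floorHalf (hG : NearlyOddTwoPebbling G r g)
    (hB : ∀ b ∈ B, H.Adj b s) (h : 8 ≤ ∑ v, C s v + ∑ b ∈ B, floorHalf (C b)) :
    PebblingReaches (G.boxProd H) (layers C) (r, s) 1 := by
  refine pebblingReaches_of_pushLayers (A := B) (b := s) (y := fun b v => C b v / 2) hB
    (fun _ _ _ => Nat.mul_div_le _ _) (pebblingReaches_layers_of_self (hG.one _ ?_))
  simp only [pushLayers, if_true, Pi.add_apply, Finset.sum_apply, Finset.sum_add_distrib]
  rw [Finset.sum_comm]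
  exact h

/-- If the layers of `s` and `B` hold enough pebbles, then `(r, s)` is reached. Otherwise every
layer of `B` has `ceilHalf` at most eight, with room for one exception `b₀`; the pairs on `(g, b₀)`
then take a detour through a layer of `A` to another layer of `B`, which they lift to nine. -/
theorem pebblingReaches_of_sum_right (hG : NearlyOddTwoPebbling G r g)
    (hH : IsPuncturedBiclique H s A B m) (hm : 3 ≤ m)
    (h : 8 * m + 8 ≤ ∑ v, C s v + ∑ b ∈ B, ∑ v, C b v) :
    PebblingReaches (G.boxProd H) (layers C) (r, s) 1 := by
  by_contra hC
  have hcard := hH.card_right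
  have hW : ∀ b ∈ B, ceilHalf (C b) ≤ 9 ∧ (ceilHalf (C b) = 9 → 9 ≤ C b g) := fun b hb =>
    hG.ceilHalf_le fun h2 => hC (pebblingReaches_of_two_at_neighbor (hH.adj_root b hb) h2)
  have ht : ∑ v, C s v + ∑ b ∈ B, floorHalf (C b) ≤ 7 := by
    by_contra! hlt
    exact hC (pebblingReaches_of_floorHalf hG hH.adj_root hlt)
  have hp : ∑ b ∈ B, ∑ v, C b v = ∑ b ∈ B, ceilHalf (C b) + ∑ b ∈ B, floorHalf (C b) := by
    rw [← Finset.sum_add_distrib]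
    exact Finset.sum_congr rfl fun b _ => (ceilHalf_add_floorHalf _).symm
  obtain ⟨b₀, hb₀, h9⟩ : ∃ b ∈ B, 9 ≤ ceilHalf (C b) := by
    by_contra! hall
    have := Finset.sum_le_card_nsmul B (fun b => ceilHalf (C b)) 8
      fun b hb => by have := hall b hb; omega
    rw [hcard, smul_eq_mul] at this
    omega
  have hg₀ : 9 ≤ C b₀ g := (hW b₀ hb₀).2 (by have := (hW b₀ hb₀).1; omega)
  have hsumt := Finset.add_sum_erase B (fun b => floorHalf (C b)) hb₀
  have hsumW := Finset.add_sum_erase B (fun b => ceilHalf (C b)) hb₀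
  have hcard' := Finset.card_erase_of_mem hb₀
  have ht₀ := half_le_floorHalf (C b₀) g
  -- The remaining layers share at most three pairs, so none of them is exceptional.
  have h8 : ∀ b ∈ B.erase b₀, ceilHalf (C b) ≤ 8 := by
    intro b hb
    by_contra! hlt
    have h1 := hW b (Finset.mem_of_mem_erase hb)
    have h2 := h1.2 (by omega)
    have h3 := half_le_floorHalf (C b) g
    have h4 := Finset.single_le_sum (f := fun b => floorHalf (C b)) (fun _ _ => Nat.zero_le _) hb
    omega
  obtain ⟨b₁, hb₁, ht₁⟩ : ∃ b ∈ B.erase b₀, floorHalf (C b) ≤ 1 := by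
    by_contra! hall
    have := Finset.card_nsmul_le_sum (B.erase b₀) (fun b => floorHalf (C b)) 2 hall
    rw [smul_eq_mul] at this
    omega
  have hW₁ : 8 ≤ ceilHalf (C b₁) := by
    have h1 := Finset.add_sum_erase (B.erase b₀) (fun b => ceilHalf (C b)) hb₁
    have h2 := Finset.sum_le_card_nsmul ((B.erase b₀).erase b₁) (fun b => ceilHalf (C b)) 8
      fun b hb => h8 b (Finset.mem_of_mem_erase hb)
    rw [smul_eq_mul, Finset.card_erase_of_mem hb₁] at h2
    have h3 := (hW b₀ hb₀).1
    omega
  obtain ⟨hne, hb₁B⟩ := Finset.mem_erase.1 hb₁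
  obtain ⟨a, ha⟩ : A.Nonempty := by
    rw [← Finset.card_pos]
    have := hH.card_left
    omega
  have hab₀ := hH.adj a ha b₀ hb₀
  have hab₁ := hH.adj a ha b₁ hb₁B
  apply hC
  refine pebblingReaches_of_pushLayers (A := {b₀}) (b := a) (y := fun _ => Pi.single g 4)
    (by simpa using hab₀.symm) ?_ ?_
  · intro b hb v
    rw [Finset.mem_singleton] at hb
    subst hb
    by_cases hv : v = g
    · subst hv; simp; omega
    · simp [hv]
  refine pebblingReaches_of_pushLayers (A := {a}) (b := b₁) (y := fun _ => Pi.single g 2)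
    (by simpa using hab₁) ?_ ?_
  · intro b hb v
    rw [Finset.mem_singleton] at hb
    subst hb
    by_cases hv : v = g
    · subst hv; simp [pushLayers]
    · simp [hv]
  refine pebblingReaches_of_two_at_neighbor (hH.adj_root b₁ hb₁B) ?_
  have e : pushLayers (pushLayers C {b₀} a fun _ => Pi.single g 4) {a} b₁
      (fun _ => Pi.single g 2) b₁ = C b₁ + Pi.single g 2 := by
    simp [pushLayers, hne, hab₁.ne.symm]
  rw [e]
  have h1 := ceilHalf_add_half_le (C b₁) (Pi.single g 2) g
  have h2 := half_le_floorHalf (C b₁) g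
  simp only [Pi.single_eq_same] at h1
  refine (hG.two _ (by omega)).resolve_right fun h3 => ?_
  have h4 := h3.2
  simp only [Pi.add_apply, Pi.single_eq_same] at h4
  omega

theorem pebblingReaches_of_gather {b : β} {k : ℕ} (hA : ∀ a ∈ A, H.Adj a b)
    (hs : PebblingReaches (G.boxProd H) (layers fun i =>
      if i = b then gathered C A b else if i ∈ A then fun v => C i v % 2 else C i) (r, s) k) :
    PebblingReaches (G.boxProd H) (layers C) (r, s) k := by
  refine pebblingReaches_of_pushLayers (A := A) (b := b) (y := fun b v => C b v / 2) hA
    (fun _ _ _ => Nat.mul_div_le _ _) (pebblingReaches_layers_mono hs fun i => ?_)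
  unfold pushLayers gathered
  split_ifs
  · exact le_rfl
  · intro v
    simp only [Pi.sub_apply, Pi.smul_apply, smul_eq_mul]
    omega
  · exact le_rfl

theorem gathered_not_two (hH : IsPuncturedBiclique H s A B m)
    (hC : ¬ PebblingReaches (G.boxProd H) (layers C) (r, s) 1) {b : β} (hb : b ∈ B) :
    ¬ PebblingReaches G (gathered C A b) r 2 := fun h2 =>
  hC (pebblingReaches_of_gather (fun a ha => hH.adj a ha b hb)
    (pebblingReaches_of_two_at_neighbor (hH.adj_root b hb) (by simpa using h2)))

theorem sum_floorHalf_gathered (hG : NearlyOddTwoPebbling G r g)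
    (hH : IsPuncturedBiclique H s A B m)
    (hC : ¬ PebblingReaches (G.boxProd H) (layers C) (r, s) 1) {b : β} (hb : b ∈ B) :
    ∑ v, C s v + floorHalf (gathered C A b) + ∑ i ∈ B.erase b, floorHalf (C i) ≤ 7 := by
  by_contra! hlt
  refine hC (pebblingReaches_of_gather (fun a ha => hH.adj a ha b hb)
    (pebblingReaches_of_floorHalf hG hH.adj_root ?_))
  have hsb : s ≠ b := (hH.adj_root b hb).ne.symm
  rw [← Finset.add_sum_erase B _ hb, if_neg hsb, if_neg hH.notMem, if_pos rfl, ← add_assoc]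
  refine hlt.trans_le (Nat.add_le_add_left (Finset.sum_le_sum fun i hi => ?_) _)
  obtain ⟨h1, h2⟩ := Finset.mem_erase.1 hi
  rw [if_neg h1, if_neg (hH.notMem_left h2)]

/-- The case in which no layer at distance two from the layer of `s` can bring two pebbles to
`r`. -/
theorem pebblingReaches_of_forall_not_two (hG : NearlyOddTwoPebbling G r g)
    (hH : IsPuncturedBiclique H s A B m) (hm : 3 ≤ m)
    (hsum : 16 * m ≤ ∑ v, C s v + ∑ a ∈ A, ∑ v, C a v + ∑ b ∈ B, ∑ v, C b v)
    (hA : ∀ a ∈ A, ¬ PebblingReaches G (C a) r 2) :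
    PebblingReaches (G.boxProd H) (layers C) (r, s) 1 := by
  by_contra hC
  have hcA := hH.card_left
  have hcB := hH.card_right
  obtain ⟨b, hb⟩ : B.Nonempty := by rw [← Finset.card_pos]; omega
  set e := (A.filter fun a => ceilHalf (C a) = 9).card with he
  have hWA : ∑ a ∈ A, ceilHalf (C a) ≤ 8 * A.card + e := by
    have : ∀ a ∈ A, ceilHalf (C a) ≤ 8 + if ceilHalf (C a) = 9 then 1 else 0 := by
      intro a ha
      have := (hG.ceilHalf_le (hA a ha)).1
      split_ifs <;> omega
    refine (Finset.sum_le_sum this).trans (le_of_eq ?_)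
    rw [Finset.sum_add_distrib, Finset.sum_const, smul_eq_mul, mul_comm, he, Finset.card_filter]
  have hpA : ∑ a ∈ A, ∑ v, C a v = ∑ a ∈ A, ceilHalf (C a) + ∑ a ∈ A, floorHalf (C a) := by
    rw [← Finset.sum_add_distrib]
    exact Finset.sum_congr rfl fun b _ => (ceilHalf_add_floorHalf _).symm
  have hsb : s ≠ b := (hH.adj_root b hb).ne.symm
  have hgat := sum_gathered C A b
  have hpB := Finset.add_sum_erase B (fun i => ∑ v, C i v) hb
  rcases Nat.eq_zero_or_pos e with h0 | hpos
  · refine hC (pebblingReaches_of_gather (fun a ha => hH.adj a ha b hb)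
      (pebblingReaches_of_sum_right hG hH hm ?_))
    have hB : ∑ i ∈ B, ∑ v, (if i = b then gathered C A b else if i ∈ A then
        fun v => C i v % 2 else C i) v =
        ∑ v, gathered C A b v + ∑ i ∈ B.erase b, ∑ v, C i v := by
      rw [← Finset.add_sum_erase B _ hb, if_pos rfl]
      refine congrArg _ (Finset.sum_congr rfl fun i hi => ?_)
      obtain ⟨h1, h2⟩ := Finset.mem_erase.1 hi
      rw [if_neg h1, if_neg (hH.notMem_left h2)]
    rw [hB, if_neg hsb, if_neg hH.notMem]
    omega
  · -- Each exceptional layer of `A` contributes four pebbles at `g`, hence two to `ceilHalf`.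
    have hy : 4 * e ≤ ∑ a ∈ A, C a g / 2 := by
      rw [he, mul_comm, ← smul_eq_mul]
      refine (Finset.card_nsmul_le_sum _ (fun a => C a g / 2) 4 fun a ha => ?_).trans
        (Finset.sum_le_sum_of_subset (Finset.filter_subset _ A))
      obtain ⟨h1, h2⟩ := Finset.mem_filter.1 ha
      have := (hG.ceilHalf_le (hA a h1)).2 h2
      omega
    have hW : ∀ i ∈ B, ceilHalf (C i) + 2 * e ≤ 9 := by
      intro i hi
      have h1 := (hG.ceilHalf_le (gathered_not_two hH hC hi)).1
      have h2 := ceilHalf_add_half_le (C i) (∑ a ∈ A, fun v => C a v / 2) g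
      rw [Finset.sum_apply] at h2
      change ceilHalf (C i) + _ ≤ ceilHalf (gathered C A i) at h2
      omega
    have h1 := (hG.ceilHalf_le (gathered_not_two hH hC hb)).1
    have h2 := sum_floorHalf_gathered hG hH hC hb
    have h3 := ceilHalf_add_floorHalf (gathered C A b)
    have h4 : ∑ i ∈ B.erase b, ∑ v, C i v =
        ∑ i ∈ B.erase b, ceilHalf (C i) + ∑ i ∈ B.erase b, floorHalf (C i) := by
      rw [← Finset.sum_add_distrib]
      exact Finset.sum_congr rfl fun b _ => (ceilHalf_add_floorHalf _).symm
    have h5 := Finset.sum_le_card_nsmul (B.erase b) (fun i => ceilHalf (C i) + 2 * e) 9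
      fun i hi => hW i (Finset.mem_of_mem_erase hi)
    rw [Finset.sum_add_distrib, Finset.sum_const, smul_eq_mul, smul_eq_mul,
      Finset.card_erase_of_mem hb] at h5
    obtain ⟨n, rfl⟩ : ∃ n, m = n + 1 := ⟨m - 1, by omega⟩
    have h6 : A.card = n := by omega
    have h7 : B.card - 1 = n := by omega
    rw [h6] at hWA
    rw [h7] at h5
    have h8 : n * (2 * e) ≤ n + e := by omega
    nlinarith

/-- The case in which exactly one layer at distance two from the layer of `s`, that of `a₀`, can
bring two pebbles to `r`. It then keeps only what it needs for this and shares the rest. -/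
theorem pebblingReaches_of_two (hG : NearlyOddTwoPebbling G r g) (hV : Fintype.card V ≤ 10)
    (hH : IsPuncturedBiclique H s A B m) (hm : 4 ≤ m)
    (hsum : 16 * m ≤ ∑ v, C s v + ∑ a ∈ A, ∑ v, C a v + ∑ b ∈ B, ∑ v, C b v) {a₀ : β}
    (ha₀ : a₀ ∈ A) (h2 : PebblingReaches G (C a₀) r 2) :
    PebblingReaches (G.boxProd H) (layers C) (r, s) 1 := by
  by_contra hC
  have hcA := hH.card_left
  have hcB := hH.card_right
  obtain ⟨b, hb⟩ : B.Nonempty := by rw [← Finset.card_pos]; omega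
  have hA : ∀ a ∈ A.erase a₀, ¬ PebblingReaches G (C a) r 2 := by
    intro a ha h
    obtain ⟨h1, h3⟩ := Finset.mem_erase.1 ha
    exact hC (pebblingReaches_of_two_and_two (hH.adj_root b hb) (hH.adj a h3 b hb)
      (hH.adj a₀ ha₀ b hb) h1 h h2)
  set e := ((A.erase a₀).filter fun a => ceilHalf (C a) = 9).card with he
  have hWA : ∑ a ∈ A.erase a₀, ceilHalf (C a) ≤ 8 * (A.erase a₀).card + e := by
    have : ∀ a ∈ A.erase a₀, ceilHalf (C a) ≤ 8 + if ceilHalf (C a) = 9 then 1 else 0 := by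
      intro a ha
      have := (hG.ceilHalf_le (hA a ha)).1
      split_ifs <;> omega
    refine (Finset.sum_le_sum this).trans (le_of_eq ?_)
    rw [Finset.sum_add_distrib, Finset.sum_const, smul_eq_mul, mul_comm, he, Finset.card_filter]
  have hpA : ∑ a ∈ A.erase a₀, ∑ v, C a v =
      ∑ a ∈ A.erase a₀, ceilHalf (C a) + ∑ a ∈ A.erase a₀, floorHalf (C a) := by
    rw [← Finset.sum_add_distrib]
    exact Finset.sum_congr rfl fun b _ => (ceilHalf_add_floorHalf _).symm
  have hsumA := Finset.add_sum_erase A (fun i => ∑ v, C i v) ha₀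
  have hsumT := Finset.add_sum_erase A (fun i => floorHalf (C i)) ha₀
  have hT : 4 * e ≤ ∑ a ∈ A.erase a₀, floorHalf (C a) := by
    rw [he, mul_comm, ← smul_eq_mul]
    refine (Finset.card_nsmul_le_sum _ (fun a => floorHalf (C a)) 4 fun a ha => ?_).trans
      (Finset.sum_le_sum_of_subset (Finset.filter_subset _ _))
    obtain ⟨h1, h3⟩ := Finset.mem_filter.1 ha
    have h4 := (hG.ceilHalf_le (hA a h1)).2 h3
    have h5 := half_le_floorHalf (C a) g
    omega
  -- The layer of `a₀` sends as many pairs as it can while `ceilHalf` stays at least ten there.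
  obtain ⟨y, hy, hyu⟩ := exists_le_sum_eq (fun v => C a₀ v / 2)
    (n := ceilHalf (C a₀) - 10) (by
      have := ceilHalf_le_floorHalf_add_card (C a₀)
      rw [floorHalf] at this
      omega)
  set u := ceilHalf (C a₀) - 10 with hu
  have hy2 : ∀ v, 2 * y v ≤ C a₀ v := fun v => by have := hy v; dsimp only at this; omega
  have hrest : PebblingReaches G (C a₀ - 2 • y) r 2 := by
    rcases le_or_gt 10 (ceilHalf (C a₀)) with h10 | h10
    · refine hG.of_ten ?_
      have := ceilHalf_sub_two_mul (C a₀) hy2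
      omega
    · have hy0 : y = 0 := by
        funext v
        have := Finset.single_le_sum (f := y) (fun _ _ => Nat.zero_le _) (Finset.mem_univ v)
        have h0 : u = 0 := by omega
        simp only [hyu, h0] at this
        simpa using this
      simpa [hy0] using h2
  have hone : ∀ i ∈ B, ∑ v, C i v + ∑ a ∈ A.erase a₀, floorHalf (C a) + u ≤ 7 := by
    intro i hi
    by_contra! hlt
    have hia : i ≠ a₀ := (hH.adj a₀ ha₀ i hi).ne.symm
    refine hC (pebblingReaches_of_pushLayers (A := A) (b := i)
      (y := fun a v => if a = a₀ then y v else C a v / 2) (fun a ha => hH.adj a ha i hi) ?_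
      (pebblingReaches_of_two_and_one (hH.adj_root i hi) (hH.adj a₀ ha₀ i hi) ?_ (hG.one _ ?_)))
    · intro a _ v
      split_ifs with h
      · subst h; exact hy2 v
      · exact Nat.mul_div_le _ _
    · simpa [pushLayers, hia.symm, ha₀] using hrest
    · simp only [pushLayers, if_true, Pi.add_apply, Finset.sum_apply, Finset.sum_add_distrib]
      rw [Finset.sum_comm, ← Finset.add_sum_erase A _ ha₀]
      have : ∑ a ∈ A.erase a₀, ∑ v, (if a = a₀ then y v else C a v / 2) =
          ∑ a ∈ A.erase a₀, floorHalf (C a) :=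
        Finset.sum_congr rfl fun a ha => by simp [(Finset.mem_erase.1 ha).1, floorHalf]
      rw [this]
      simp only [if_true, hyu]
      omega
  have hall : ∀ i ∈ B, ∑ v, C i v + ∑ a ∈ A, floorHalf (C a) + ∑ v, C s v ≤ 16 := by
    intro i hi
    have h1 := (hG.ceilHalf_le (gathered_not_two hH hC hi)).1
    have h3 := sum_floorHalf_gathered hG hH hC hi
    have h4 := ceilHalf_add_floorHalf (gathered C A i)
    have h5 := sum_gathered C A i
    omega
  have h₁ := Finset.sum_le_card_nsmul B _ 7 hone
  have h₂ := Finset.sum_le_card_nsmul B _ 16 hall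
  simp only [Finset.sum_add_distrib, Finset.sum_const, smul_eq_mul, hcB] at h₁ h₂
  have h₃ := ceilHalf_add_floorHalf (C a₀)
  rw [Finset.card_erase_of_mem ha₀] at hWA
  obtain ⟨n, rfl⟩ : ∃ n, m = n + 2 := ⟨m - 2, by omega⟩
  have h₄ : A.card - 1 = n := by omega
  rw [h₄] at hWA
  have h₅ : ceilHalf (C a₀) ≤ 10 + u := by omega
  clear_value u e
  generalize ∑ a ∈ A.erase a₀, floorHalf (C a) = T' at *
  generalize ∑ a ∈ A.erase a₀, ceilHalf (C a) = W' at *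
  generalize ∑ a ∈ A, floorHalf (C a) = T at *
  generalize ceilHalf (C a₀) = W₀ at *
  generalize floorHalf (C a₀) = t₀ at *
  generalize ∑ i ∈ B, ∑ v, C i v = P at *
  generalize ∑ v, C s v = x at *
  have k₁ : 8 * n + 32 ≤ x + P + e + T + W₀ := by omega
  have k₂ : P + (n + 2) * (4 * e) + (n + 2) * u ≤ (n + 2) * 7 :=
    (Nat.add_le_add_right (Nat.add_le_add_left (Nat.mul_le_mul_left _ hT) _) _).trans h₁
  have k₃ := Nat.mul_le_mul_left (n + 1) k₂
  have k₄ := Nat.mul_le_mul_left (n + 2) k₁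
  have k₅ := Nat.mul_le_mul_left (n + 2) h₅
  have k₆ : (n + 2) * (8 * n + 16 + 4 * (n + 1) * e + (n + 1) * u) ≤
      (n + 2) * (7 * n + 17 + e + u) := by linarith
  have k₇ := Nat.le_of_mul_le_mul_left k₆ (by omega)
  have k₈ := Nat.zero_le (n * e)
  have k₉ := Nat.zero_le (n * u)
  have k₀ : 2 ≤ n := by omega
  linarith

/-- A configuration with `16 * m` pebbles on a product with a balanced complete bipartite graph
with sides of size `m` reaches `(r, s)`. -/
theorem pebblingReaches_boxProd (hG : NearlyOddTwoPebbling G r g) (hV : Fintype.card V ≤ 10)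
    (hH : IsPuncturedBiclique H s A B m) (hm : 4 ≤ m)
    (hsum : 16 * m ≤ ∑ v, C s v + ∑ a ∈ A, ∑ v, C a v + ∑ b ∈ B, ∑ v, C b v) :
    PebblingReaches (G.boxProd H) (layers C) (r, s) 1 := by
  by_cases h : ∃ a ∈ A, PebblingReaches G (C a) r 2
  · obtain ⟨a, ha, h2⟩ := h
    exact pebblingReaches_of_two hG hV hH hm hsum ha h2
  · push Not at h
    exact pebblingReaches_of_forall_not_two hG hH (by omega) hsum h

end Product

/-! ### Tree strategies -/

/-- A rooted tree with vertices labelled by natural numbers, built by grafting: `graft t s` is `t`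
with `s` hung below its root, as a further child. It encodes the strategy that pushes all pebbles
along the edges towards the root, starting from the leaves. -/
inductive PushTree
  | vertex (v : ℕ)
  | graft (t s : PushTree)

namespace PushTree

/-- The root of a tree. -/
def root : PushTree → ℕ
  | vertex v => v
  | graft t _ => t.root

/-- The vertices of a tree, with multiplicity. -/
def verts : PushTree → List ℕ
  | vertex v => [v]
  | graft t s => t.verts ++ s.verts

/-- The edges of a tree, directed towards the root. -/
def edges : PushTree → List (ℕ × ℕ)
  | vertex _ => []
  | graft t s => (s.root, t.root) :: (t.edges ++ s.edges)

/-- The number of pebbles that the strategy `t` brings to its root from the configuration `f`. -/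
noncomputable def value (f : ℕ → ℕ) (t : PushTree) : ℕ :=
  PushTree.rec f (fun _ _ a b => Nat.add a (Nat.div b 2)) t

/-- The sum of the labels `f` over the vertices of a tree. -/
def weight (f : ℕ → ℕ) : PushTree → ℕ
  | vertex v => f v
  | graft t s => t.weight f + s.weight f

/-- The restriction of `f` to the vertices of a tree, counted with multiplicity. -/
def pile (f : ℕ → ℕ) : PushTree → ℕ → ℕ
  | vertex v => fun i => if i = v then f v else 0
  | graft t s => t.pile f + s.pile f

@[simp] theorem value_vertex (f : ℕ → ℕ) (v : ℕ) : value f (vertex v) = f v := rfl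

@[simp] theorem value_graft (f : ℕ → ℕ) (t s : PushTree) :
    value f (graft t s) = value f t + value f s / 2 := rfl

theorem weight_eq_sum (f : ℕ → ℕ) (t : PushTree) : t.weight f = (t.verts.map f).sum := by
  induction t with
  | vertex v => simp [weight, verts]
  | graft t s iht ihs => simp [weight, verts, iht, ihs]

theorem pile_eq_count (f : ℕ → ℕ) (t : PushTree) (i : ℕ) :
    t.pile f i = t.verts.count i * f i := by
  induction t with
  | vertex v =>
    by_cases h : i = v
    · subst h; simp [pile, verts]
    · simp [pile, verts, h, Ne.symm h]
  | graft t s iht ihs => simp [pile, verts, iht, ihs, add_mul]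

theorem pile_le_of_nodup (f : ℕ → ℕ) {t : PushTree} (ht : t.verts.Nodup) (i : ℕ) :
    t.pile f i ≤ f i := by
  rw [pile_eq_count]
  exact (Nat.mul_le_mul_right _ (List.nodup_iff_count_le_one.1 ht i)).trans (by simp)

end PushTree

/-- Every pair in the list is an edge of `G`. -/
def EdgesOf {n : ℕ} (G : SimpleGraph (Fin n)) (E : List (ℕ × ℕ)) : Prop :=
  ∀ e ∈ E, ∃ (hu : e.1 < n) (hv : e.2 < n), G.Adj ⟨e.1, hu⟩ ⟨e.2, hv⟩

theorem PushTree.reaches_pile {n : ℕ} {G : SimpleGraph (Fin n)} (f : ℕ → ℕ) (t : PushTree)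
    (ht : EdgesOf G t.edges) (hr : t.root < n) :
    PebblingReaches G (fun i : Fin n => t.pile f i) ⟨t.root, hr⟩ (t.value f) := by
  induction t with
  | vertex v => exact .of_le_apply (by simp [pile, root])
  | graft t s iht ihs =>
    obtain ⟨hu, hv, huv⟩ := ht (s.root, t.root) (by simp [edges])
    obtain ⟨a, ha, ha'⟩ := iht (fun e he => ht e (by simp [edges, he])) hv
    obtain ⟨b, hb, hb'⟩ := ihs (fun e he => ht e (by simp [edges, he])) hu
    have h1 := (pebblingMoves_add_right ha (fun i : Fin n => s.pile f i)).trans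
      (pebblingMoves_add_left hb a)
    have h2 : b - Pi.single ⟨s.root, hu⟩ (2 * (s.value f / 2)) +
        Pi.single ⟨s.root, hu⟩ (2 * (s.value f / 2)) = b := by
      refine tsub_add_cancel_of_le fun i => ?_
      by_cases hi : i = ⟨s.root, hu⟩
      · subst hi
        simpa using (Nat.mul_div_le _ 2).trans hb'
      · simp [hi]
    have h3 := pebblingMoves_add_left (pebbling_moves_along_edge huv (s.value f / 2)
      (b - Pi.single ⟨s.root, hu⟩ (2 * (s.value f / 2)))) a
    rw [h2] at h3
    refine .of_moves (c' := _) (h1.trans h3) (.of_le_apply ?_)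
    simp only [Pi.add_apply, root, Pi.single_eq_same, value_graft]
    omega

/-! ### Exhaustive search

The functions below are evaluated by the kernel on several thousand configurations. They are written
with recursors and with the binary operations of `Nat` so that they unfold in few steps. -/

namespace PebblingSearch

/-- The entry of a list at an index, and zero beyond its end. -/
noncomputable def entry (l : List ℕ) : ℕ → ℕ :=
  List.rec (fun _ => 0) (fun x _ ih i => Nat.rec x (fun j _ => ih j) i) l

/-- Apply `f` to the entry of a list at an index. -/
noncomputable def alter (f : ℕ → ℕ) (l : List ℕ) : ℕ → List ℕ :=
  List.rec (fun _ => [])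
    (fun x xs ih i => Nat.rec (f x :: xs) (fun j _ => x :: ih j) i) l

/-- `P` holds for all natural numbers up to `n`. -/
noncomputable def allUpTo (P : ℕ → Bool) (n : ℕ) : Bool :=
  Nat.rec (P 0) (fun n ih => and (P (Nat.succ n)) ih) n

/-- `P` holds for some member of the list. -/
noncomputable def anyOf {α : Type*} (P : α → Bool) (l : List α) : Bool :=
  List.rec false (fun x _ ih => or (P x) ih) l

/-- The number of pebbles that stands for a cost `x`: it is `x` for `q = 1`, and the least number
whose rounded-up half is `x` for `q = 2`. -/
def pebbles (q x : ℕ) : ℕ := Nat.sub (Nat.mul q x) (Nat.sub q 1)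

/-- The largest cost whose number of pebbles is at most `B`, capped by `n`. -/
noncomputable def maxCost (q B n : ℕ) : ℕ :=
  cond (Nat.ble n (Nat.div (Nat.add B (Nat.sub q 1)) q)) n (Nat.div (Nat.add B (Nat.sub q 1)) q)

/-- Runs through the configurations on the vertices of `t` of cost at most `n` from which the
strategy `t` brings at most `B` pebbles to its root. The continuation `K` receives the number of
pebbles brought to the root, the remaining cost and the configuration added to `acc`. -/
noncomputable def forallFailing (q : ℕ) (t : PushTree) :
    ℕ → ℕ → List ℕ → (ℕ → ℕ → List ℕ → Bool) → Bool :=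
  PushTree.rec
    (fun v B n acc K => allUpTo
      (fun x => K (pebbles q x) (Nat.sub n x) (alter (fun y => Nat.add y (pebbles q x)) acc v))
      (maxCost q B n))
    (fun _ _ iht ihs B n acc K =>
      ihs (Nat.succ (Nat.mul 2 B)) n acc fun y n' acc' =>
        iht (Nat.sub B (Nat.div y 2)) n' acc' fun z => K (Nat.add z (Nat.div y 2))) t

/-- Some strategy in `S` brings `k` pebbles to its root. -/
noncomputable def anyStrategy (S : List PushTree) (k : ℕ) (l : List ℕ) : Bool :=
  anyOf (fun t => Nat.ble k (t.value (entry l))) S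

/-- After at most `n` moves along pairs in `E`, some strategy in `S` brings `k` pebbles to its
root. -/
noncomputable def search (E : List (ℕ × ℕ)) (S : List PushTree) (k n : ℕ) : List ℕ → Bool :=
  Nat.rec (anyStrategy S k) (fun _ ih l => or (anyStrategy S k l)
    (anyOf (fun e => and (Nat.ble 2 (entry l e.1))
      (ih (alter (fun y => Nat.add y 1) (alter (fun y => Nat.sub y 2) l e.1) e.2))) E)) n

/-- All configurations of cost `N` reach `k` pebbles at the root of `t`, except possibly some with
nine pebbles at `g`. -/
noncomputable def check (E : List (ℕ × ℕ)) (t t' : PushTree) (g q N k : ℕ) : Bool :=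
  forallFailing q t (Nat.sub k 1) N [0, 0, 0, 0, 0, 0, 0, 0] fun _ n l =>
    or (Nat.ble 1 n) (or (Nat.beq (entry l g) 9) (search E [t, t'] k 3 l))

/-! ### Correctness of the search -/

theorem entry_alter (f : ℕ → ℕ) (l : List ℕ) (i j : ℕ) (hi : i < l.length) :
    entry (alter f l i) j = if j = i then f (entry l i) else entry l j := by
  induction l generalizing i j with
  | nil => simp at hi
  | cons x xs ih =>
    cases i with
    | zero => cases j <;> rfl
    | succ i =>
      cases j with
      | zero => rfl
      | succ j =>
        have := ih i j (by simpa using hi)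
        change entry (alter f xs i) j = if j + 1 = i + 1 then f (entry xs i) else entry xs j
        simpa using this

theorem length_alter (f : ℕ → ℕ) (l : List ℕ) (i : ℕ) (hi : i < l.length) :
    (alter f l i).length = l.length := by
  induction l generalizing i with
  | nil => simp at hi
  | cons x xs ih =>
    cases i with
    | zero => rfl
    | succ i =>
      change (alter f xs i).length + 1 = _
      rw [ih i (by simpa using hi), List.length_cons]

theorem allUpTo_spec {P : ℕ → Bool} {n : ℕ} (h : allUpTo P n = true) {x : ℕ} (hx : x ≤ n) :
    P x = true := by
  induction n with
  | zero => obtain rfl : x = 0 := by omega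
            exact h
  | succ n ih =>
    obtain ⟨h1, h2⟩ := (Bool.and_eq_true_iff (x := P (n + 1)) (y := allUpTo P n)).1 h
    rcases Nat.lt_or_ge n x with hlt | hle
    · obtain rfl : x = n + 1 := by omega
      exact h1
    · exact ih h2 hle

theorem anyOf_spec {α : Type*} {P : α → Bool} {l : List α} (h : anyOf P l = true) :
    ∃ x ∈ l, P x = true := by
  induction l with
  | nil => exact absurd h Bool.false_ne_true
  | cons x xs ih =>
    rcases (Bool.or_eq_true_iff (x := P x) (y := anyOf P xs)).1 h with h | h
    · exact ⟨x, by simp, h⟩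
    · obtain ⟨y, hy, h⟩ := ih h
      exact ⟨y, by simp [hy], h⟩

theorem le_maxCost {q B n x : ℕ} (hq : 0 < q) (hB : pebbles q x ≤ B) (hn : x ≤ n) :
    x ≤ maxCost q B n := by
  have h : x ≤ (B + (q - 1)) / q := by
    rw [Nat.le_div_iff_mul_le hq, mul_comm]
    change q * x - (q - 1) ≤ B at hB
    omega
  unfold maxCost
  cases Nat.ble n (Nat.div (Nat.add B (Nat.sub q 1)) q)
  · exact h
  · exact hn

theorem forallFailing_spec {q : ℕ} (hq : 0 < q) {m : ℕ} (b : ℕ → ℕ) (t : PushTree)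
    (ht : ∀ v ∈ t.verts, v < m) {B n : ℕ} {acc : List ℕ} {K : ℕ → ℕ → List ℕ → Bool}
    (hm : acc.length = m) (h : forallFailing q t B n acc K = true)
    (hB : t.value (fun v => pebbles q (b v)) ≤ B) (hn : t.weight b ≤ n) :
    ∃ l : List ℕ, l.length = m ∧
      K (t.value fun v => pebbles q (b v)) (n - t.weight b) l = true ∧
      ∀ i, entry l i = entry acc i + t.pile (fun v => pebbles q (b v)) i := by
  induction t generalizing B n acc K with
  | vertex v =>
    have hv : v < acc.length := hm ▸ ht v (by simp [PushTree.verts])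
    have hx := allUpTo_spec (P := fun x => K (pebbles q x) (Nat.sub n x)
      (alter (fun y => Nat.add y (pebbles q x)) acc v)) h (le_maxCost hq hB hn)
    refine ⟨_, by rw [length_alter _ _ _ hv, hm], hx, fun i => ?_⟩
    rw [entry_alter _ _ _ _ hv]
    by_cases hi : i = v
    · subst hi; simp [PushTree.pile]
    · simp [PushTree.pile, hi]
  | graft t s iht ihs =>
    simp only [PushTree.value_graft, PushTree.weight] at hB hn
    obtain ⟨l, hl, hK, hlp⟩ := ihs (fun v hv => ht v (by simp [PushTree.verts, hv])) hm h
      (by simp only [Nat.succ_eq_add_one, Nat.mul_eq]; omega) (by omega)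
    obtain ⟨l', hl', hK', hlp'⟩ := iht (fun v hv => ht v (by simp [PushTree.verts, hv])) hl hK
      (by change _ ≤ B - _ / 2; omega) (by omega)
    refine ⟨l', hl', ?_, fun i => ?_⟩
    · rw [PushTree.weight, Nat.add_comm, ← Nat.sub_sub]
      exact hK'
    · rw [hlp', hlp, PushTree.pile, Pi.add_apply]
      omega

/-- The tree uses only edges in `E` and spans eight vertices. -/
def IsSpanning (E : List (ℕ × ℕ)) (t : PushTree) : Prop :=
  (∀ e ∈ t.edges, e ∈ E) ∧ t.verts.Perm (List.range 8)

instance (E : List (ℕ × ℕ)) (t : PushTree) : Decidable (IsSpanning E t) :=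
  inferInstanceAs (Decidable (_ ∧ _))

section Soundness

variable {G : SimpleGraph (Fin 8)} {E : List (ℕ × ℕ)} {r : Fin 8} {k : ℕ}

theorem reaches_of_value (hE : EdgesOf G E) {t : PushTree} (ht : IsSpanning E t)
    (hr : t.root = r) {f : ℕ → ℕ} {c : Fin 8 → ℕ} (hc : ∀ i : Fin 8, f i ≤ c i)
    (hk : k ≤ t.value f) : PebblingReaches G c r k := by
  obtain ⟨c', hc', hk'⟩ := t.reaches_pile f (fun e he => hE e (ht.1 e he)) (hr ▸ r.2)
  have hr' : (⟨t.root, hr ▸ r.2⟩ : Fin 8) = r := Fin.ext hr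
  rw [hr'] at hk'
  have hnd : t.verts.Nodup := ht.2.nodup_iff.2 List.nodup_range
  exact PebblingReaches.mono ⟨c', hc', hk.trans hk'⟩
    fun i => (t.pile_le_of_nodup f hnd i).trans (hc i)

theorem reaches_of_search (hE : EdgesOf G E) {S : List PushTree}
    (hS : ∀ t ∈ S, IsSpanning E t ∧ t.root = r) {n : ℕ} {l : List ℕ} (hl : l.length = 8)
    (h : search E S k n l = true) : PebblingReaches G (fun i : Fin 8 => entry l i) r k := by
  have base : ∀ l : List ℕ, anyStrategy S k l = true →
      PebblingReaches G (fun i : Fin 8 => entry l i) r k := by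
    intro l h
    obtain ⟨t, ht, hk⟩ := anyOf_spec h
    exact reaches_of_value hE (hS t ht).1 (hS t ht).2 (fun _ => le_rfl) (Nat.le_of_ble_eq_true hk)
  induction n generalizing l with
  | zero => exact base l h
  | succ n ih =>
    rcases (Bool.or_eq_true_iff (x := anyStrategy S k l)).1 h with h | h
    · exact base l h
    obtain ⟨e, he, h⟩ := anyOf_spec h
    obtain ⟨h2, h⟩ := (Bool.and_eq_true_iff (x := Nat.ble 2 (entry l e.1))).1 h
    have h2 := Nat.le_of_ble_eq_true h2
    obtain ⟨hu, hv, huv⟩ := hE e he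
    have hul : e.1 < l.length := hl ▸ hu
    have hvl : e.2 < (alter (fun y => Nat.sub y 2) l e.1).length := by
      rw [length_alter _ _ _ hul, hl]; exact hv
    refine PebblingReaches.of_moves (.single ⟨⟨e.1, hu⟩, ⟨e.2, hv⟩, huv, ?_⟩)
      (ih (by rw [length_alter _ _ _ hvl, length_alter _ _ _ hul, hl]) h)
    have hne : e.1 ≠ e.2 := fun h => huv.ne (Fin.ext h)
    ext i
    simp only [Pi.add_apply, entry_alter _ _ _ _ hvl, entry_alter _ _ _ _ hul]
    simp only [Pi.single_apply, Fin.ext_iff, Nat.add_eq, Nat.sub_eq]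
    by_cases h1 : (i : ℕ) = e.1
    · simp only [h1, hne, if_true, if_false]; omega
    · by_cases h3 : (i : ℕ) = e.2
      · simp [h3, hne.symm]
      · simp [h1, h3]

/-- Extension of a configuration on `Fin 8` by zero. -/
def extend (c : Fin 8 → ℕ) (v : ℕ) : ℕ := if h : v < 8 then c ⟨v, h⟩ else 0

theorem weight_extend {t : PushTree} (ht : t.verts.Perm (List.range 8)) (b : Fin 8 → ℕ) :
    t.weight (extend b) = ∑ v, b v := by
  rw [PushTree.weight_eq_sum, (ht.map _).sum_eq]
  simp [List.range_succ, extend, Fin.sum_univ_succ]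

theorem reaches_of_check (hE : EdgesOf G E) {t t' : PushTree} (ht : IsSpanning E t)
    (ht' : IsSpanning E t') (hr : t.root = r) (hr' : t'.root = r) {g : Fin 8} {q N : ℕ}
    (hq : 0 < q) (hk : 0 < k) (h : check E t t' g q N k = true) {b : Fin 8 → ℕ}
    (hb : ∑ v, b v = N) :
    pebbles q (b g) = 9 ∨ PebblingReaches G (fun v => pebbles q (b v)) r k := by
  have hext : ∀ i : Fin 8, extend b i = b i := fun i => by simp [extend]
  rcases Nat.lt_or_ge (t.value fun v => pebbles q (extend b v)) k with hlt | hge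
  · have hw := weight_extend ht.2 b
    obtain ⟨l, hl, hK, hlp⟩ := forallFailing_spec (m := 8) hq (extend b) t
      (fun v hv => List.mem_range.1 (ht.2.mem_iff.1 hv)) rfl h
      (by simp only [Nat.sub_eq]; omega) (by omega)
    have hlb : ∀ i : Fin 8, entry l i = pebbles q (b i) := by
      intro i
      have h0 : entry [0, 0, 0, 0, 0, 0, 0, 0] i = 0 := by fin_cases i <;> rfl
      have h1 : t.verts.count (i : ℕ) = 1 := by
        rw [ht.2.count_eq]
        exact List.count_eq_one_of_mem List.nodup_range (List.mem_range.2 i.2)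
      rw [hlp, h0, PushTree.pile_eq_count, h1, hext, zero_add, one_mul]
    have hN : N - t.weight (extend b) = 0 := by omega
    rw [hN] at hK
    rcases (Bool.or_eq_true_iff (x := Nat.beq (entry l g) 9)).1 hK with h9 | hs
    · exact .inl (by rw [← hlb]; exact Nat.eq_of_beq_eq_true h9)
    · refine .inr ?_
      have := reaches_of_search (r := r) hE (by simp [ht, ht', hr, hr']) hl hs
      simpa only [hlb] using this
  · exact .inr (reaches_of_value hE ht hr (fun i => by rw [hext]) hge)

theorem nearlyOddTwoPebbling_of_check (hE : EdgesOf G E) {t t' : PushTree} (ht : IsSpanning E t)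
    (ht' : IsSpanning E t') (hr : t.root = r) (hr' : t'.root = r) {g : Fin 8}
    (h1 : check E t t' g 1 8 1 = true) (h2 : check E t t' g 2 9 2 = true) :
    NearlyOddTwoPebbling G r g where
  one c hc := by
    obtain ⟨b, hb, hs⟩ := exists_le_sum_eq c hc
    rcases reaches_of_check hE ht ht' hr hr' one_pos one_pos h1 hs with h | h
    · have := Finset.single_le_sum (f := b) (fun _ _ => Nat.zero_le _) (Finset.mem_univ g)
      simp only [pebbles, Nat.mul_eq, Nat.sub_eq] at h
      omega
    · exact h.mono fun v => by simpa [pebbles] using hb v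
  two c hc := by
    have key : ∀ b : Fin 8 → ℕ, (∀ v, b v ≤ (c v + 1) / 2) → ∑ v, b v = 9 →
        b g = 5 ∨ PebblingReaches G c r 2 := by
      intro b hb hs
      refine (reaches_of_check hE ht ht' hr hr' two_pos two_pos h2 hs).imp (fun h => ?_)
        fun h => h.mono fun v => ?_
      · simp only [pebbles, Nat.mul_eq, Nat.sub_eq] at h
        omega
      · have := hb v
        simp only [pebbles, Nat.mul_eq, Nat.sub_eq]
        omega
    rcases hc.eq_or_lt with h9 | h10
    · rcases key _ (fun _ => le_rfl) h9.symm with h | h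
      · exact .inr ⟨h9.symm, by omega⟩
      · exact .inl h
    left
    -- Among the costs below the rounded-up halves of `c` there is one other than five at `g`.
    obtain ⟨b, hb, hs, h5⟩ : ∃ b : Fin 8 → ℕ, (∀ v, b v ≤ (c v + 1) / 2) ∧ ∑ v, b v = 9 ∧
        b g ≠ 5 := by
      have hg := Finset.add_sum_erase Finset.univ (fun v => (c v + 1) / 2) (Finset.mem_univ g)
      change _ = ceilHalf c at hg
      have hg' (x : ℕ) := Finset.add_sum_erase Finset.univ
        (Function.update (fun v => (c v + 1) / 2) g x) (Finset.mem_univ g)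
      have hu (x : ℕ) : ∑ v ∈ Finset.univ.erase g,
          Function.update (fun v => (c v + 1) / 2) g x v =
            ∑ v ∈ Finset.univ.erase g, (c v + 1) / 2 :=
        Finset.sum_congr rfl fun v hv => by simp [(Finset.mem_erase.1 hv).1]
      simp only [hu, Function.update_self] at hg'
      rcases Nat.lt_or_ge ((c g + 1) / 2) 6 with hlt | hge
      · obtain ⟨b, hb, hs⟩ := exists_le_sum_eq
          (Function.update (fun v => (c v + 1) / 2) g (min 4 ((c g + 1) / 2))) (n := 9) (by
            rw [← hg']; omega)
        refine ⟨b, fun v => ?_, hs, ?_⟩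
        · have := hb v
          by_cases hv : v = g
          · subst hv; simp at this; omega
          · simpa [hv] using this
        · have := hb g
          simp at this
          omega
      · obtain ⟨b, hb, hs⟩ := exists_le_sum_eq
          (Function.update (fun v => (c v + 1) / 2) g ((c g + 1) / 2 - 6)) (n := 3) (by
            rw [← hg']; omega)
        refine ⟨b + Pi.single g 6, fun v => ?_, by simp [Finset.sum_add_distrib, hs], by simp⟩
        have := hb v
        by_cases hv : v = g
        · subst hv; simp at this ⊢; omega
        · simpa [hv] using this
    exact (key b hb hs).resolve_left h5

end Soundness

end PebblingSearch

/-! ### Strategies on the Lemke graphs -/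

/-- The tree with root `v` and the given trees below it. -/
def PushTree.node (v : ℕ) (l : List PushTree) : PushTree := l.foldl graft (vertex v)

open PebblingSearch in
/-- The data `D`, two spanning trees and a vertex, passes the exhaustive search for the root `r` in
a graph with the given list of edges. -/
def IsCertificate (E : List (ℕ × ℕ)) (r : Fin 8) (D : PushTree × PushTree × Fin 8) : Prop :=
  (IsSpanning (E ++ E.map Prod.swap) D.1 ∧ D.1.root = r) ∧
  (IsSpanning (E ++ E.map Prod.swap) D.2.1 ∧ D.2.1.root = r) ∧
  check (E ++ E.map Prod.swap) D.1 D.2.1 D.2.2 1 8 1 = true ∧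
  check (E ++ E.map Prod.swap) D.1 D.2.1 D.2.2 2 9 2 = true

noncomputable instance (E : List (ℕ × ℕ)) (r : Fin 8) (D : PushTree × PushTree × Fin 8) :
    Decidable (IsCertificate E r D) :=
  inferInstanceAs (Decidable ((_ ∧ _) ∧ (_ ∧ _) ∧ _ ∧ _))

theorem IsCertificate.nearlyOddTwoPebbling {G : SimpleGraph (Fin 8)} {E : List (ℕ × ℕ)}
    (hE : EdgesOf G E) {r : Fin 8} {D : PushTree × PushTree × Fin 8} (h : IsCertificate E r D) :
    NearlyOddTwoPebbling G r D.2.2 := by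
  obtain ⟨⟨h1, h2⟩, ⟨h3, h4⟩, h5, h6⟩ := h
  refine PebblingSearch.nearlyOddTwoPebbling_of_check (fun e he => ?_) h1 h3 h2 h4 h5 h6
  rcases List.mem_append.1 he with he | he
  · exact hE e he
  · obtain ⟨e', he', rfl⟩ := List.mem_map.1 he
    obtain ⟨hu, hv, huv⟩ := hE e' he'
    exact ⟨hv, hu, huv.symm⟩

section Data

open PushTree

/-- The edges of `lemkeGraph`, as pairs of numbers. -/
def lemkeEdges : List (ℕ × ℕ) :=
  [(0, 1), (0, 2), (1, 3), (2, 4), (2, 5), (2, 6), (3, 4), (3, 5), (3, 6), (3, 7), (4, 7),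
    (5, 7), (6, 7)]

/-- For each root two spanning trees of `lemkeGraph`, followed by the vertex `g` of the exceptional
configurations, or by the root itself where there is no exception. -/
def lemkeStrategies : Fin 8 → PushTree × PushTree × Fin 8 :=
  ![
    (node 0 [node 1 [vertex 3], node 2 [node 4 [vertex 7], vertex 5, vertex 6]],
      node 0 [node 1 [node 3 [vertex 7]], node 2 [vertex 4, vertex 5, vertex 6]], 7),
    (node 1 [node 0 [vertex 2], node 3 [vertex 4, vertex 5, vertex 6, vertex 7]],
      node 1 [vertex 0, node 3 [node 4 [vertex 2], vertex 5, vertex 6, vertex 7]], 1),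
    (node 2 [node 0 [vertex 1], node 4 [vertex 3, vertex 7], vertex 5, vertex 6],
      node 2 [vertex 4, node 5 [node 3 [node 1 [vertex 0]]], node 6 [vertex 7]], 2),
    (node 3 [node 1 [vertex 0], node 4 [vertex 2], vertex 5, vertex 6, vertex 7],
      node 3 [node 5 [node 2 [node 0 [vertex 1], vertex 4, vertex 6]], vertex 7], 3),
    (node 4 [node 2 [vertex 0, vertex 5, vertex 6], node 3 [vertex 1], vertex 7],
      node 4 [node 3 [node 1 [node 0 [vertex 2]]], node 7 [vertex 5, vertex 6]], 4),
    (node 5 [node 2 [vertex 0, vertex 4, vertex 6], node 3 [vertex 1], vertex 7],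
      node 5 [node 3 [node 1 [node 0 [vertex 2]]], node 7 [vertex 4, vertex 6]], 5),
    (node 6 [node 2 [vertex 0, vertex 4, vertex 5], node 3 [vertex 1], vertex 7],
      node 6 [node 3 [node 1 [node 0 [vertex 2]]], node 7 [vertex 4, vertex 5]], 6),
    (node 7 [node 3 [node 1 [vertex 0]], node 4 [vertex 2], vertex 5, vertex 6],
      node 7 [node 3 [vertex 1], vertex 4, node 5 [node 2 [vertex 0]], vertex 6], 7)]

/-- The edges of `lemkeGraph1`, as pairs of numbers. -/
def lemke1Edges : List (ℕ × ℕ) :=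
  [(0, 1), (0, 2), (1, 2), (1, 3), (2, 4), (2, 5), (2, 6), (3, 4), (3, 7), (4, 7), (5, 7),
    (6, 7)]

/-- For each root two spanning trees of `lemkeGraph1`, followed by the vertex `g` of the exceptional
configurations, or by the root itself where there is no exception. -/
def lemke1Strategies : Fin 8 → PushTree × PushTree × Fin 8 :=
  ![
    (node 0 [node 1 [vertex 3], node 2 [node 4 [vertex 7], vertex 5, vertex 6]],
      node 0 [node 1 [node 3 [vertex 7]], node 2 [vertex 4, vertex 5, vertex 6]], 7),
    (node 1 [vertex 0, node 2 [vertex 4, vertex 5, vertex 6], node 3 [vertex 7]],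
      node 1 [vertex 0, node 2 [node 4 [vertex 7], vertex 5, vertex 6], vertex 3], 1),
    (node 2 [vertex 0, vertex 1, node 4 [vertex 3, vertex 7], vertex 5, vertex 6],
      node 2 [node 1 [vertex 0, vertex 3], vertex 4, node 5 [vertex 7], vertex 6], 2),
    (node 3 [node 1 [vertex 0, vertex 2], vertex 4, node 7 [vertex 5, vertex 6]],
      node 3 [node 1 [vertex 0], node 4 [node 2 [vertex 5, vertex 6]], vertex 7], 3),
    (node 4 [node 2 [vertex 0, vertex 1, vertex 5, vertex 6], vertex 3, vertex 7],
      node 4 [node 3 [node 1 [node 0 [vertex 2]]], node 7 [vertex 5, vertex 6]], 4),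
    (node 5 [node 2 [vertex 0, vertex 1, vertex 4, vertex 6], node 7 [vertex 3]],
      node 5 [node 7 [node 3 [node 1 [node 0 [vertex 2]]], vertex 4, vertex 6]], 5),
    (node 6 [node 2 [vertex 0, vertex 1, vertex 4, vertex 5], node 7 [vertex 3]],
      node 6 [node 7 [node 3 [node 1 [node 0 [vertex 2]]], vertex 4, vertex 5]], 6),
    (node 7 [node 3 [node 1 [vertex 0]], node 4 [vertex 2], vertex 5, vertex 6],
      node 7 [node 3 [vertex 1], vertex 4, node 5 [node 2 [vertex 0]], vertex 6], 7)]

/-- The edges of `lemkeGraph2`, as pairs of numbers. -/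
def lemke2Edges : List (ℕ × ℕ) :=
  [(0, 1), (0, 2), (1, 3), (2, 4), (2, 5), (2, 6), (3, 4), (3, 6), (3, 7), (4, 5), (4, 7),
    (5, 6), (5, 7), (6, 7)]

/-- For each root two spanning trees of `lemkeGraph2`, followed by the vertex `g` of the exceptional
configurations, or by the root itself where there is no exception. -/
def lemke2Strategies : Fin 8 → PushTree × PushTree × Fin 8 :=
  ![
    (node 0 [node 1 [vertex 3], node 2 [node 4 [vertex 7], vertex 5, vertex 6]],
      node 0 [node 1 [node 3 [vertex 7]], node 2 [vertex 4, vertex 5, vertex 6]], 7),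
    (node 1 [node 0 [vertex 2], node 3 [node 4 [vertex 5], vertex 6, vertex 7]],
      node 1 [node 0 [node 2 [vertex 5]], node 3 [vertex 4, vertex 6, vertex 7]], 5),
    (node 2 [node 0 [vertex 1], node 4 [vertex 3, vertex 7], vertex 5, vertex 6],
      node 2 [vertex 4, node 5 [vertex 7], node 6 [node 3 [node 1 [vertex 0]]]], 2),
    (node 3 [node 1 [vertex 0], node 4 [vertex 2, vertex 5], vertex 6, vertex 7],
      node 3 [node 6 [node 2 [node 0 [vertex 1], vertex 4]], node 7 [vertex 5]], 3),
    (node 4 [node 2 [vertex 0, vertex 6], node 3 [vertex 1], vertex 5, vertex 7],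
      node 4 [node 3 [node 1 [node 0 [node 2 [vertex 5]]]], node 7 [vertex 6]], 4),
    (node 5 [node 2 [node 0 [vertex 1]], node 4 [vertex 3], vertex 6, vertex 7],
      node 5 [node 2 [vertex 0], vertex 4, node 6 [node 3 [vertex 1]], vertex 7], 5),
    (node 6 [node 2 [vertex 0, vertex 4], node 3 [vertex 1], vertex 5, vertex 7],
      node 6 [node 3 [node 1 [node 0 [vertex 2]], vertex 7], node 5 [vertex 4]], 6),
    (node 7 [node 3 [node 1 [vertex 0]], node 4 [vertex 2], vertex 5, vertex 6],
      node 7 [node 3 [vertex 1], vertex 4, node 5 [node 2 [vertex 0]], vertex 6], 7)]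

end Data

theorem lemke_isCertificate : ∀ r, IsCertificate lemkeEdges r (lemkeStrategies r) := by
  decide +kernel

theorem lemke1_isCertificate : ∀ r, IsCertificate lemke1Edges r (lemke1Strategies r) := by
  decide +kernel

theorem lemke2_isCertificate : ∀ r, IsCertificate lemke2Edges r (lemke2Strategies r) := by
  decide +kernel

/-- All three graphs satisfy the hypothesis of the product argument. The exceptions do occur: in each
graph, one pebble on each of `3, 4, 5, 6` and nine on `7` do not bring two pebbles to `0`. -/
theorem exists_nearlyOddTwoPebbling_of_mem {G : SimpleGraph (Fin 8)}
    (hG : G ∈ ({lemkeGraph, lemkeGraph1, lemkeGraph2} : Set (SimpleGraph (Fin 8)))) (r : Fin 8) :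
    ∃ g, NearlyOddTwoPebbling G r g := by
  rcases hG with rfl | rfl | rfl
  · exact ⟨_, (lemke_isCertificate r).nearlyOddTwoPebbling
      (by simp [EdgesOf, lemkeEdges, lemkeGraph])⟩
  · exact ⟨_, (lemke1_isCertificate r).nearlyOddTwoPebbling
      (by simp [EdgesOf, lemke1Edges, lemkeGraph1])⟩
  · exact ⟨_, (lemke2_isCertificate r).nearlyOddTwoPebbling
      (by simp [EdgesOf, lemke2Edges, lemkeGraph2])⟩

/-! ### Graham's inequality -/

/-- Graham's inequality for `G` on eight vertices and `H` on `2 * m`. Only the lower bounds `8` and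
`2 * m` for the two pebbling numbers are needed on the right-hand side. -/
theorem pebblingNumber_boxProd_le {V β : Type*} [Fintype V] [DecidableEq V] [Fintype β]
    [DecidableEq β] {G : SimpleGraph V} {H : SimpleGraph β} {m : ℕ}
    (hV : Fintype.card V = 8) (hG : ∀ r, ∃ g, NearlyOddTwoPebbling G r g) (hH : H.Connected)
    (hm : 4 ≤ m) (hβ : Fintype.card β = 2 * m) (hAB : ∀ s, ∃ A B, IsPuncturedBiclique H s A B m) :
    pebblingNumber (G.boxProd H) ≤ pebblingNumber G * pebblingNumber H := by
  have h1 : 8 ≤ pebblingNumber G := hV ▸ card_le_pebblingNumber ⟨8, by norm_num, fun c hc r =>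
    (hG r).choose_spec.one c hc.ge⟩
  have h2 : 2 * m ≤ pebblingNumber H :=
    hβ ▸ card_le_pebblingNumber ⟨_, (pebblingNumber_isLeast hH).1⟩
  refine (Nat.sInf_le ⟨by omega, fun c hc => ?_⟩ : pebblingNumber (G.boxProd H) ≤ 16 * m).trans ?_
  · rintro ⟨r, s⟩
    obtain ⟨g, hg⟩ := hG r
    obtain ⟨A, B, h⟩ := hAB s
    refine pebblingReaches_boxProd (C := fun b v => c (v, b)) hg (by omega) h hm ?_
    have hdisj : Disjoint A B := Finset.disjoint_left.2 fun i hi hi' => h.notMem_left hi' hi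
    have hs : s ∉ A ∪ B := by
      rw [Finset.mem_union]
      rintro (hs | hs)
      · exact h.notMem hs
      · exact (h.adj_root s hs).ne rfl
    have huniv : insert s (A ∪ B) = Finset.univ := by
      rw [← Finset.card_eq_iff_eq_univ, Finset.card_insert_of_notMem hs,
        Finset.card_union_of_disjoint hdisj, hβ, ← h.card_left, h.card_right]
      have := h.card_left
      omega
    rw [← hc, Fintype.sum_prod_type, Finset.sum_comm, ← huniv, Finset.sum_insert hs,
      Finset.sum_union hdisj, add_assoc]
  · calc 16 * m = 8 * (2 * m) := by ring
      _ ≤ _ := Nat.mul_le_mul h1 h2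

theorem exists_isPuncturedBiclique_completeGraph {β : Type*} [Fintype β] {m : ℕ}
    (hβ : Fintype.card β = 2 * m) (s : β) :
    ∃ A B, IsPuncturedBiclique (SimpleGraph.completeGraph β) s A B m := by
  classical
  have hpos : 0 < Fintype.card β := Fintype.card_pos_iff.2 ⟨s⟩
  have hcard : (Finset.univ.erase s).card = 2 * m - 1 := by
    rw [Finset.card_erase_of_mem (Finset.mem_univ s), Finset.card_univ, hβ]
  obtain ⟨A, hA, hAm⟩ := Finset.exists_subset_card_eq (s := Finset.univ.erase s) (n := m - 1)
    (by omega)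
  refine ⟨A, Finset.univ.erase s \ A, fun h => by simpa using hA h, fun b hb => ?_,
    fun a ha b hb => ?_, by omega, ?_⟩
  · simp only [Finset.mem_sdiff, Finset.mem_erase] at hb
    simpa using hb.1.1
  · rintro rfl
    exact (Finset.mem_sdiff.1 hb).2 ha
  · rw [Finset.card_sdiff_of_subset hA, hcard]
    omega

theorem exists_isPuncturedBiclique_completeBipartiteGraph {m : ℕ} (s : Fin m ⊕ Fin m) :
    ∃ A B, IsPuncturedBiclique (completeBipartiteGraph (Fin m) (Fin m)) s A B m := by
  rcases s with i | i
  · exact ⟨(Finset.univ.erase i).map .inl, Finset.univ.map .inr, by simp, by simp, by simp,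
      by have := i.pos; simp; omega, by simp⟩
  · exact ⟨(Finset.univ.erase i).map .inr, Finset.univ.map .inl, by simp, by simp, by simp,
      by have := i.pos; simp; omega, by simp⟩

theorem completeBipartiteGraph_connected {V W : Type*} [Nonempty V] [Nonempty W] :
    (completeBipartiteGraph V W).Connected := by
  obtain ⟨v₀⟩ := ‹Nonempty V›
  obtain ⟨w₀⟩ := ‹Nonempty W›
  have hadj (v : V) (w : W) : (completeBipartiteGraph V W).Adj (.inl v) (.inr w) := by simp
  refine SimpleGraph.connected_iff_exists_forall_reachable _ |>.2 ⟨.inl v₀, ?_⟩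
  rintro (v | w)
  · exact (hadj v₀ w₀).reachable.trans (hadj v w₀).symm.reachable
  · exact (hadj v₀ w).reachable

theorem mainTheorem2 :
    ∀ G ∈ ({lemkeGraph, lemkeGraph1, lemkeGraph2} : Set (SimpleGraph (Fin 8))),
      pebblingNumber (G.boxProd (SimpleGraph.completeGraph (Fin 8))) ≤
          pebblingNumber G * pebblingNumber (SimpleGraph.completeGraph (Fin 8)) ∧
      pebblingNumber (G.boxProd (SimpleGraph.completeGraph (Fin 12))) ≤
          pebblingNumber G * pebblingNumber (SimpleGraph.completeGraph (Fin 12)) ∧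
      pebblingNumber (G.boxProd (completeBipartiteGraph (Fin 4) (Fin 4))) ≤
          pebblingNumber G * pebblingNumber (completeBipartiteGraph (Fin 4) (Fin 4)) ∧
      pebblingNumber (G.boxProd (completeBipartiteGraph (Fin 6) (Fin 6))) ≤
          pebblingNumber G * pebblingNumber (completeBipartiteGraph (Fin 6) (Fin 6)) := by
  intro G hG
  have hG' := exists_nearlyOddTwoPebbling_of_mem hG
  have hV : Fintype.card (Fin 8) = 8 := Fintype.card_fin 8
  refine ⟨?_, ?_, ?_, ?_⟩
  · exact pebblingNumber_boxProd_le (m := 4) hV hG' SimpleGraph.connected_top (by norm_num)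
      (by simp) (exists_isPuncturedBiclique_completeGraph (by simp))
  · exact pebblingNumber_boxProd_le (m := 6) hV hG' SimpleGraph.connected_top (by norm_num)
      (by simp) (exists_isPuncturedBiclique_completeGraph (by simp))
  · exact pebblingNumber_boxProd_le (m := 4) hV hG' completeBipartiteGraph_connected (by norm_num)
      (by simp) exists_isPuncturedBiclique_completeBipartiteGraph
  · exact pebblingNumber_boxProd_le (m := 6) hV hG' completeBipartiteGraph_connected (by norm_num)
      (by simp) exists_isPuncturedBiclique_completeBipartiteGraph
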